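/- Let $b=\lambda+i\eta$ with $\lambda,\eta\in\mathbb R$, let $k\ge 0$ be an integer, and put $$c_n^{(b)}=\frac{\eta}{\lambda+n-1},\qquad d_{n+1}^{(\lambda)}=\frac14\,\frac{n(n+2\lambda-1)}{(n+\lambda-1)(n+\lambda)},\qquad n\ge 1 .$$ The $k$-th associated complementary Romanovski–Routh (CRR) polynomials are given by $\mathcal P_0^{(k)}(b;x)=1$, $\mathcal P_1^{(k)}(b;x)=x-c_{k+1}^{(b)}$ and $$\mathcal P_{n+1}^{(k)}(b;x)=(x-c_{k+n+1}^{(b)})\,\mathcal P_n^{(k)}(b;x)-d_{k+n+1}^{(\lambda)}(x^2+1)\,\mathcal P_{n-1}^{(k)}(b;x),\qquad n\ge1 .$$ Assume that either $k=0$ and $\lambda>1/2$, or $k\ge1$ and $\lambda>0$. For $n\ge 1$ let $$M_n^{(\lambda;k)}=\frac12\,\frac{k+n-1}{\lambda+k+n-1}\ \text{ if } 0<\lambda\le\tfrac12,\qquad M_n^{(\lambda;k)}=\frac12\,\frac{2\lambda+k+n-2}{\lambda+k+n-1}\ \text{ if } \lambda>\tfrac12 .$$ Then $\{M_n^{(\lambda;k)}\}_{n\ge1}$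 is the maximal parameter sequence of the positive chain sequence $\{d_{k+n}^{(\lambda)}\}_{n\ge2}$; that is, among all sequences $(g_n)_{n\ge1}$ with $0\le g_1<1$, $0<g_n<1$ for $n\ge2$ and $d_{k+n+1}^{(\lambda)}=(1-g_n)g_{n+1}$ for $n\ge1$, it is the termwise largest. Let $\nu^{(b;k)}$ be the probability measure on the unit circle, not supported on finitely many points, whose Verblunsky coefficients $\beta_{n-1}=-\overline{\Phi_n(0)}$, $n\ge 1$ (where $\Phi_n$ is the monic orthogonal polynomial of degree $n$ for the measure), are $$\beta_{n-1}^{(b;k)}=\frac{1}{\tau_{n-1}^{(b;k)}}\,\frac{1-2M_n^{(\lambda;k)}-ic_{k+n}^{(b)}}{1-ic_{k+n}^{(b)}},\quad n\ge1,\qquad \tau_0^{(b;k)}=1,\quad \tau_n^{(b;k)}=\tau_{n-1}^{(b;k)}\,\frac{1-ic_{k+n}^{(b)}}{1+ic_{k+n}^{(b)}} .$$ Let $d\varphi^{(b;k)}(x)=d\nu^{(b;k)}\big((x+i)/(x-i)\big)$, i.e. $\varphi^{(b;k)}(B)=\nu^{(b;k)}(\{(x+i)/(x-i):x\in B\})$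 for Borel sets $B\subset\mathbb R$. Then for all $n\ge0$ $$\int_{-\infty}^{\infty}x^j\,\frac{\mathcal P_n^{(k)}(b;x)}{(x^2+1)^n}\,d\varphi^{(b;k)}(x)=\gamma_n^{(b;k)}\delta_{n,j},\qquad j=0,1,\dots,n,$$ where $\gamma_0^{(b;k)}=1$ and $\gamma_n^{(b;k)}=(1-M_n^{(\lambda;k)})\gamma_{n-1}^{(b;k)}$ for $n\ge1$. Moreover, for all $n\ge0$ and all real $x$, $$\mathcal P_n^{(k+1)}(b;x)=\int_{-\infty}^{\infty}\frac{(1+x^2)^{n+1}\mathcal P_{n+1}^{(k)}(b;t)-(1+t^2)^{n+1}\mathcal P_{n+1}^{(k)}(b;x)}{M_1^{(\lambda;k)}\,(t-x)\,(1+t^2)^{n+1}}\,d\varphi^{(b;k)}(t),$$ where the integrand at $t=x$ is understood as its limit for $t\to x$. All these integrals converge absolutely. -/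

import Mathlib

open MeasureTheory Polynomial ComplexConjugate

namespace CRR

noncomputable section

/-- `c_n^{(b)} = η / (λ + n - 1)`, `n ≥ 1`, where `b = λ + i η`. -/
def c (b : ℂ) (n : ℕ) : ℝ := b.im / (b.re + n - 1)

/-- `d_n^{(λ)}`, `n ≥ 2`; that is, `d_{n+1} = n (n + 2λ - 1) / (4 (n + λ - 1) (n + λ))` for
`n ≥ 1`. -/
def d (lam : ℝ) (n : ℕ) : ℝ :=
  (1 / 4) * (((n : ℝ) - 1) * ((n : ℝ) + 2 * lam - 2)) / (((n : ℝ) + lam - 2) * ((n : ℝ) + lam - 1))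

/-- `P b k n` is the `k`-th associated complementary Romanovski-Routh polynomial of index `n`. -/
def P (b : ℂ) (k : ℕ) : ℕ → ℝ[X]
  | 0 => 1
  | 1 => X - C (c b (k + 1))
  | n + 2 => (X - C (c b (k + n + 2))) * P b k (n + 1)
      - C (d b.re (k + n + 2)) * (X ^ 2 + 1) * P b k n

/-- `g_1, g_2, …` is a parameter sequence of the positive chain sequence `a_2, a_3, …`.
The values `g 0`, `a 0`, `a 1` play no role. -/
def IsParameterSequence (a g : ℕ → ℝ) : Prop :=
  (0 ≤ g 1 ∧ g 1 < 1) ∧ (∀ n, 2 ≤ n → 0 < g n ∧ g n < 1) ∧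
    ∀ n, 1 ≤ n → a (n + 1) = (1 - g n) * g (n + 1)

/-- The maximal parameter sequence: it dominates every parameter sequence termwise. -/
def IsMaximalParameterSequence (a g : ℕ → ℝ) : Prop :=
  IsParameterSequence a g ∧
    ∀ g' : ℕ → ℝ, IsParameterSequence a g' → ∀ n, 1 ≤ n → g' n ≤ g n

/-- The explicit sequence `M_n^{(λ;k)}`, `n ≥ 1`. -/
def M (lam : ℝ) (k n : ℕ) : ℝ :=
  if lam ≤ 1 / 2 then (1 / 2) * (((k : ℝ) + n - 1) / (lam + k + n - 1))
  else (1 / 2) * ((2 * lam + k + n - 2) / (lam + k + n - 1))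

/-- `τ_0 = 1`, `τ_n = τ_{n-1} (1 - i c_{k+n}) / (1 + i c_{k+n})`. -/
def tau (b : ℂ) (k : ℕ) : ℕ → ℂ
  | 0 => 1
  | n + 1 => tau b k n *
      ((1 - Complex.I * (c b (k + (n + 1)) : ℂ)) / (1 + Complex.I * (c b (k + (n + 1)) : ℂ)))

/-- `beta b k n` is
`β_n = (1 / τ_n) (1 - 2 M_{n+1} - i c_{k+n+1}) / (1 - i c_{k+n+1})`, `n ≥ 0`. -/
def beta (b : ℂ) (k n : ℕ) : ℂ :=
  (1 / tau b k n) *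
    ((1 - 2 * (M b.re k (n + 1) : ℂ) - Complex.I * (c b (k + (n + 1)) : ℂ)) /
      (1 - Complex.I * (c b (k + (n + 1)) : ℂ)))

/-- `γ_0 = 1`, `γ_n = (1 - M_n) γ_{n-1}`. -/
def gam (lam : ℝ) (k : ℕ) : ℕ → ℝ
  | 0 => 1
  | n + 1 => (1 - M lam k (n + 1)) * gam lam k n

/-- `Φ` is the monic orthogonal polynomial of degree `n` for a measure `ν` on the unit circle. -/
def IsMonicOPUC (ν : Measure ℂ) (n : ℕ) (Φ : ℂ[X]) : Prop :=
  Φ.Monic ∧ Φ.natDegree = n ∧ ∀ j, j < n → ∫ z, conj (z ^ j) * Φ.eval z ∂ν = 0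

/-- `ν` is not supported on finitely many points, and `β_n = - conj (Φ_{n+1}(0))` for its monic
orthogonal polynomials `Φ_n`. -/
def HasVerblunskyCoeffs (ν : Measure ℂ) (β : ℕ → ℂ) : Prop :=
  (∀ s : Set ℂ, s.Finite → ν sᶜ ≠ 0) ∧
    ∃ Φ : ℕ → ℂ[X], (∀ n, IsMonicOPUC ν n (Φ n)) ∧ ∀ n, β n = -conj ((Φ (n + 1)).eval 0)

/-- The parametrization `x ↦ (x + i) / (x - i)` of the unit circle without the point `1`. -/
def cayley (x : ℝ) : ℂ := ((x : ℂ) + Complex.I) / ((x : ℂ) - Complex.I)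

/-- The measure `dφ(x) = dν((x + i) / (x - i))` on the real line: `φ(B) = ν(cayley '' B)`. -/
def lineMeasure (ν : Measure ℂ) : Measure ℝ := ν.comap cayley

/-- The quotient
`((1 + x²)^m P_m^{(k)}(t) - (1 + t²)^m P_m^{(k)}(x)) / (t - x)`, a polynomial in `t`.
The numerator vanishes at `t = x`, so `dslope` gives this quotient for `t ≠ x`, and its limit
(the derivative of the numerator) at `t = x`. -/
def divDiff (b : ℂ) (k m : ℕ) (x t : ℝ) : ℝ :=
  dslope (fun s : ℝ => (1 + x ^ 2) ^ m * (P b k m).eval s - (1 + s ^ 2) ^ m * (P b k m).eval x) x t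

end

end CRR

/-!
With `u_n = c_{k+n}`, `g_n = M_n` and `ℓ_n = ∏_{j ≤ n} (1 + i u_j)`, the polynomial
`ℓ_n z Φ_n - conj ℓ_n Φ_n^*` vanishes at `z = 1`, and the Szegő recursion becomes a
three-term recurrence for its quotient `R_n` by `z - 1`, which the Cayley transform carries to the
recurrence of the `P_n`. Orthogonality of `Φ_n` makes all moments of `R_n` from index `0` to
`n` equal, and this becomes the orthogonality of `P_n / (x ^ 2 + 1) ^ n`.

Wall's criterion does the rest: the series `∑ ∏_{j ≤ n} M_j / (1 - M_j)` diverges, being bounded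
below by a harmonic series. Divergence forces the parameter sequence to be maximal. It also excludes
an atom of `ν` at `1`, the only point of the circle missing from the image of the line: the partial
sums of that series are `|R_n(1)|² / ∫ |R_n|² dν`, and an atom would bound them.

The integral of the second kind satisfies the shifted recurrence because the defect
`p_n - (t + x) p_{n+1}`, where `p_n = P_n / (t ^ 2 + 1) ^ n`, integrates to zero for `n ≥ 1`.
-/

namespace CRR

/-! ### Chain sequences -/

section ChainSequence

variable {a g : ℕ → ℝ}

/-- The `n`-th term `∏_{j ≤ n} g_j / (1 - g_j)` of the series whose divergence is Wall's criterion
for the parameter sequence `g_1, g_2, …` to be maximal. -/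
noncomputable def wallTerm (g : ℕ → ℝ) (n : ℕ) : ℝ :=
  ∏ j ∈ Finset.range n, g (j + 1) / (1 - g (j + 1))

lemma wallTerm_succ (g : ℕ → ℝ) (n : ℕ) :
    wallTerm g (n + 1) = wallTerm g n * (g (n + 1) / (1 - g (n + 1))) :=
  Finset.prod_range_succ _ _

lemma IsParameterSequence.nonneg (hg : IsParameterSequence a g) (n : ℕ) : 0 ≤ g (n + 1) := by
  rcases n with _ | n
  · exact hg.1.1
  · exact (hg.2.1 (n + 2) (by omega)).1.le

lemma IsParameterSequence.lt_one (hg : IsParameterSequence a g) (n : ℕ) : g (n + 1) < 1 := by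
  rcases n with _ | n
  · exact hg.1.2
  · exact (hg.2.1 (n + 2) (by omega)).2

lemma IsParameterSequence.eq_mul (hg : IsParameterSequence a g) (n : ℕ) :
    a (n + 2) = (1 - g (n + 1)) * g (n + 2) :=
  hg.2.2 (n + 1) (by omega)

lemma IsParameterSequence.wallTerm_nonneg (hg : IsParameterSequence a g) (n : ℕ) :
    0 ≤ wallTerm g n :=
  Finset.prod_nonneg fun j _ => div_nonneg (hg.nonneg j) (sub_nonneg.2 (hg.lt_one j).le)

lemma IsParameterSequence.sub_pos_succ {g' : ℕ → ℝ} (hg : IsParameterSequence a g)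
    (hg' : IsParameterSequence a g') {n : ℕ} (hn : 0 < g' (n + 1) - g (n + 1)) :
    0 < g' (n + 2) - g (n + 2) := by
  have hpos : 0 < (1 - g' (n + 1)) * (g' (n + 2) - g (n + 2)) :=
    calc 0 < (g' (n + 1) - g (n + 1)) * g (n + 2) := mul_pos hn (hg.2.1 (n + 2) (by omega)).1
      _ = _ := by linear_combination hg'.eq_mul n - hg.eq_mul n
  exact pos_of_mul_pos_right hpos (sub_nonneg.2 (hg'.lt_one n).le)

lemma IsParameterSequence.wallTerm_mul_div_sub_succ {g' : ℕ → ℝ} (hg : IsParameterSequence a g)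
    (hg' : IsParameterSequence a g') {n : ℕ} (hn : 0 < g' (n + 1) - g (n + 1)) :
    wallTerm g (n + 2) * (1 - g (n + 2)) / (g' (n + 2) - g (n + 2))
      = wallTerm g (n + 1) * (1 - g (n + 1)) / (g' (n + 1) - g (n + 1)) - wallTerm g (n + 1) := by
  have hn' := hg.sub_pos_succ hg' hn
  have hne : 1 - g (n + 2) ≠ 0 := (sub_pos.2 (hg.lt_one (n + 1))).ne'
  rw [wallTerm_succ, div_sub' hn.ne', div_eq_div_iff hn'.ne' hn.ne']
  field_simp
  linear_combination wallTerm g (n + 1) * (hg'.eq_mul n - hg.eq_mul n)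

/-- Wall's criterion. A second parameter sequence `g'` that exceeds `g` at one index exceeds it from
there on, and the positive quantities `w_n (1 - g_n) / (g'_n - g_n)` then decrease by `w_n` at each
step, so that the sum of the `w_n` is finite. -/
theorem IsParameterSequence.isMaximal_of_not_summable (hg : IsParameterSequence a g)
    (hw : ¬ Summable (wallTerm g)) : IsMaximalParameterSequence a g := by
  refine ⟨hg, fun g' hg' n hn => ?_⟩
  obtain ⟨N, rfl⟩ := Nat.exists_eq_add_of_le' hn
  by_contra! hlt
  set T : ℕ → ℝ := fun n => wallTerm g (n + 1) * (1 - g (n + 1)) / (g' (n + 1) - g (n + 1))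
  have hgap : ∀ m, 0 < g' (m + N + 1) - g (m + N + 1) := by
    intro m
    induction m with
    | zero => simpa only [zero_add] using sub_pos.2 hlt
    | succ m ih => simpa only [add_right_comm m 1 N] using hg.sub_pos_succ hg' ih
  have hsum : ∀ m, ∑ i ∈ Finset.range m, wallTerm g (i + (N + 1)) = T N - T (m + N) := by
    intro m
    induction m with
    | zero => simp only [Finset.range_zero, Finset.sum_empty, zero_add, sub_self]
    | succ m ih =>
      have hT : T (m + N + 1) = T (m + N) - wallTerm g (m + N + 1) :=
        hg.wallTerm_mul_div_sub_succ hg' (hgap m)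
      rw [Finset.sum_range_succ, ih, add_right_comm m 1 N, hT, ← add_assoc]
      ring
  have hT_nonneg : ∀ m, 0 ≤ T (m + N) := fun m =>
    div_nonneg (mul_nonneg (hg.wallTerm_nonneg _) (sub_nonneg.2 (hg.lt_one _).le)) (hgap m).le
  refine hw ((summable_nat_add_iff (N + 1)).1 (summable_of_sum_range_le (c := T N)
    (fun i => hg.wallTerm_nonneg _) fun m => ?_))
  linarith [hsum m, hT_nonneg m]

end ChainSequence

/-- The borderline case of Raabe's test. -/
lemma not_summable_of_add_mul_le {w : ℕ → ℝ} {r : ℝ} (hr : 0 ≤ r) (hw : ∀ n, 0 < w n)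
    (h : ∀ n : ℕ, (r + n) * w n ≤ (r + (n + 1 : ℕ)) * w (n + 1)) : ¬ Summable w := by
  intro hs
  have hmono : Monotone fun n : ℕ => (r + n) * w n := monotone_nat_of_le_succ h
  have hle (n : ℕ) : (r + 1) * w 1 * (1 / |(n : ℝ) + (r + 1)| ^ (1 : ℝ)) ≤ w (n + 1) := by
    have hpos : (0 : ℝ) < n + (r + 1) := by positivity
    rw [Real.rpow_one, abs_of_pos hpos, mul_one_div, div_le_iff₀ hpos]
    have := hmono (Nat.le_add_left 1 n)
    push_cast at this
    linarith
  have hw1 : (r + 1) * w 1 ≠ 0 := (mul_pos (by positivity) (hw 1)).ne'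
  have hs' := Summable.of_nonneg_of_le
    (fun n : ℕ => mul_nonneg (mul_nonneg (by positivity) (hw 1).le) (by positivity)) hle
    ((summable_nat_add_iff 1).2 hs)
  exact lt_irrefl _ ((Real.summable_one_div_nat_add_rpow _ _).1 ((summable_mul_left_iff hw1).1 hs'))

/-! ### The chain sequence of the complementary Romanovski–Routh polynomials -/

/-- The range of `λ` and `k` in which every `M_n^{(λ;k)}`, `n ≥ 1`, lies strictly between `0` and
`1` and no denominator vanishes. -/
def Admissible (lam : ℝ) (k : ℕ) : Prop :=
  1 / 2 < lam ∨ (1 ≤ k ∧ 0 < 2 * lam + k)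

section Admissible

variable {lam : ℝ} {k : ℕ}

lemma Admissible.add_pos (h : Admissible lam k) : 0 < lam + k := by
  rcases h with h | ⟨-, h⟩ <;> linarith [k.cast_nonneg (α := ℝ)]

lemma M_succ_of_le_half (hl : lam ≤ 1 / 2) (n : ℕ) :
    M lam k (n + 1) = (k + n) / (2 * (lam + k + n)) := by
  rw [M, if_pos hl, one_div_mul_eq_div, div_div, mul_comm _ (2 : ℝ)]
  push_cast
  ring_nf

lemma M_succ_of_half_lt (hl : 1 / 2 < lam) (n : ℕ) :
    M lam k (n + 1) = (2 * lam + k + n - 1) / (2 * (lam + k + n)) := by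
  rw [M, if_neg hl.not_ge, one_div_mul_eq_div, div_div, mul_comm _ (2 : ℝ)]
  push_cast
  ring_nf

lemma Admissible.M_succ_pos_and_lt_one (h : Admissible lam k) (n : ℕ) :
    0 < M lam k (n + 1) ∧ M lam k (n + 1) < 1 := by
  have hden : 0 < lam + k + n := add_pos_of_pos_of_nonneg h.add_pos n.cast_nonneg
  rcases le_or_gt lam (1 / 2) with hl | hl
  · obtain ⟨hk1, hlk⟩ := h.resolve_left hl.not_gt
    have hk1_real : (1 : ℝ) ≤ k := Nat.one_le_cast.2 hk1
    have hn : (0 : ℝ) ≤ n := n.cast_nonneg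
    rw [M_succ_of_le_half hl, div_lt_one (by positivity)]
    exact ⟨by positivity, by linarith only [hk1_real, hlk, hn]⟩
  · rw [M_succ_of_half_lt hl, div_lt_one (by positivity)]
    exact ⟨div_pos (by linarith) (by positivity), by linarith⟩

lemma Admissible.d_eq_mul (h : Admissible lam k) (n : ℕ) :
    d lam (k + (n + 2)) = (1 - M lam k (n + 1)) * M lam k (n + 2) := by
  have hden : 0 < lam + k + n := add_pos_of_pos_of_nonneg h.add_pos n.cast_nonneg
  have h1 : lam + k + n ≠ 0 := hden.ne'
  have h2 : lam + k + n + 1 ≠ 0 := (_root_.add_pos hden one_pos).ne'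
  have hd : d lam (k + (n + 2))
      = (k + n + 1) * (k + n + 2 * lam) / (4 * ((lam + k + n) * (lam + k + n + 1))) := by
    rw [d, show ((k + (n + 2) : ℕ) : ℝ) + lam - 2 = lam + k + n by push_cast; ring,
      show ((k + (n + 2) : ℕ) : ℝ) + lam - 1 = lam + k + n + 1 by push_cast; ring]
    push_cast
    field_simp
    ring
  have hn : lam + k + ((n + 1 : ℕ) : ℝ) = lam + k + n + 1 := by push_cast; ring
  rw [hd]
  rcases le_or_gt lam (1 / 2) with hl | hl
  · rw [M_succ_of_le_half hl, M_succ_of_le_half hl, hn]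
    push_cast
    field_simp
    ring
  · rw [M_succ_of_half_lt hl, M_succ_of_half_lt hl, hn]
    push_cast
    field_simp
    ring

lemma Admissible.isParameterSequence (h : Admissible lam k) :
    IsParameterSequence (fun n => d lam (k + n)) (M lam k) := by
  refine ⟨(h.M_succ_pos_and_lt_one 0).imp_left le_of_lt, fun n hn => ?_, fun n hn => ?_⟩ <;>
    obtain ⟨m, rfl⟩ := Nat.exists_eq_add_of_le' (show 1 ≤ n by omega)
  · exact h.M_succ_pos_and_lt_one m
  · exact h.d_eq_mul m

lemma Admissible.le_M_div_one_sub (h : Admissible lam k) (n : ℕ) :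
    (k + n : ℝ) / (k + n + 1) ≤ M lam k (n + 1) / (1 - M lam k (n + 1)) := by
  have hden : 0 < lam + k + n := add_pos_of_pos_of_nonneg h.add_pos n.cast_nonneg
  rw [div_le_div_iff₀ (by positivity) (by linarith [(h.M_succ_pos_and_lt_one n).2])]
  suffices (k + n : ℝ) / (2 * (k + n) + 1) ≤ M lam k (n + 1) by
    rw [div_le_iff₀ (by positivity)] at this
    linarith
  rcases le_or_gt lam (1 / 2) with hl | hl
  · rw [M_succ_of_le_half hl]
    gcongr
    linarith
  · rw [M_succ_of_half_lt hl, div_le_div_iff₀ (by positivity) (by positivity)]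
    nlinarith [mul_nonneg (by positivity : (0 : ℝ) ≤ k + n + 1) (sub_nonneg.2 hl.le)]

lemma Admissible.not_summable_wallTerm (h : Admissible lam k) :
    ¬ Summable (wallTerm (M lam k)) := by
  have hpos : ∀ n, 0 < wallTerm (M lam k) n := fun n => Finset.prod_pos fun j _ =>
    div_pos (h.M_succ_pos_and_lt_one j).1 (sub_pos.2 (h.M_succ_pos_and_lt_one j).2)
  refine not_summable_of_add_mul_le k.cast_nonneg hpos fun n => ?_
  have hratio := h.le_M_div_one_sub n
  rw [div_le_iff₀ (by positivity)] at hratio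
  calc (k + n : ℝ) * wallTerm (M lam k) n
      ≤ M lam k (n + 1) / (1 - M lam k (n + 1)) * (k + n + 1) * wallTerm (M lam k) n :=
        mul_le_mul_of_nonneg_right hratio (hpos n).le
    _ = (k + (n + 1 : ℕ)) * wallTerm (M lam k) (n + 1) := by
        rw [wallTerm_succ]
        push_cast
        ring

end Admissible

/-! ### Orthogonal polynomials on the unit circle -/

section UnitCircle

lemma conj_mul_self_of_norm_eq_one {z : ℂ} (hz : ‖z‖ = 1) : conj z * z = 1 := by
  rw [Complex.conj_mul', hz, Complex.ofReal_one, one_pow]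

lemma conj_pow_mul_pow_of_norm_eq_one {z : ℂ} (hz : ‖z‖ = 1) {j n : ℕ} (hj : j ≤ n) :
    conj z ^ j * z ^ n = z ^ (n - j) := by
  rw [← Nat.add_sub_of_le hj, pow_add, ← mul_assoc, ← mul_pow, conj_mul_self_of_norm_eq_one hz,
    one_pow, one_mul, Nat.add_sub_cancel_left]

variable {ν : Measure ℂ}

lemma ae_norm_eq_one (hν : ν (Metric.sphere (0 : ℂ) 1)ᶜ = 0) : ∀ᵐ z ∂ν, ‖z‖ = 1 := by
  filter_upwards [compl_mem_ae_iff.2 hν] with z hz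
  exact mem_sphere_zero_iff_norm.1 (not_not.1 hz)

lemma eq_zero_of_ae_eval_eq_zero (hs : ∀ s : Set ℂ, s.Finite → ν sᶜ ≠ 0) {p : ℂ[X]}
    (hp : ∀ᵐ z ∂ν, p.eval z = 0) : p = 0 := by
  by_contra h
  exact hs {z | p.IsRoot z} (p.finite_setOfPred_isRoot h) hp

lemma IsMonicOPUC.coeff_self {n : ℕ} {p : ℂ[X]} (hp : IsMonicOPUC ν n p) : p.coeff n = 1 := by
  rw [← hp.2.1]
  exact hp.1

variable [IsFiniteMeasure ν]

lemma integrable_of_continuous {E : Type*} [NormedAddCommGroup E]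
    (hν : ν (Metric.sphere (0 : ℂ) 1)ᶜ = 0) {f : ℂ → E} (hf : Continuous f) :
    Integrable f ν := by
  obtain ⟨B, hB⟩ := (isCompact_sphere (0 : ℂ) 1).exists_bound_of_continuousOn hf.continuousOn
  refine Integrable.of_bound hf.aestronglyMeasurable B ?_
  filter_upwards [ae_norm_eq_one hν] with z hz
  exact hB z (mem_sphere_zero_iff_norm.2 hz)

/-- The inner product `p ↦ ⟨z ^ j, p⟩` of `L²(ν)` on polynomials, for a measure `ν` on the unit
circle; the support condition enters because integrability makes the functional linear. -/
noncomputable def moment (hν : ν (Metric.sphere (0 : ℂ) 1)ᶜ = 0) (j : ℕ) : ℂ[X] →ₗ[ℂ] ℂ where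
  toFun p := ∫ z, conj (z ^ j) * p.eval z ∂ν
  map_add' p q := by
    simp only [eval_add, mul_add]
    exact integral_add (integrable_of_continuous hν (by fun_prop))
      (integrable_of_continuous hν (by fun_prop))
  map_smul' r p := by
    simp only [eval_smul, smul_eq_mul, mul_left_comm _ r, integral_const_mul, RingHom.id_apply]

variable (hν : ν (Metric.sphere (0 : ℂ) 1)ᶜ = 0)

lemma moment_apply (j : ℕ) (p : ℂ[X]) : moment hν j p = ∫ z, conj (z ^ j) * p.eval z ∂ν := rfl

lemma moment_C_mul (j : ℕ) (r : ℂ) (p : ℂ[X]) : moment hν j (C r * p) = r * moment hν j p := by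
  rw [← smul_eq_C_mul, map_smul, smul_eq_mul]

lemma moment_succ_X_mul (j : ℕ) (p : ℂ[X]) : moment hν (j + 1) (X * p) = moment hν j p := by
  rw [moment_apply, moment_apply]
  refine integral_congr_ae ?_
  filter_upwards [ae_norm_eq_one hν] with z hz
  rw [eval_mul, eval_X, pow_succ, map_mul]
  linear_combination conj (z ^ j) * p.eval z * conj_mul_self_of_norm_eq_one hz

lemma moment_X_pow_mul (i j : ℕ) (p : ℂ[X]) :
    moment hν (j + i) (X ^ i * p) = moment hν j p := by
  induction i with
  | zero => rw [pow_zero, one_mul, add_zero]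
  | succ i ih => rw [pow_succ', mul_assoc, ← add_assoc, moment_succ_X_mul, ih]

lemma integral_norm_eval_sq (p : ℂ[X]) :
    ((∫ z, ‖p.eval z‖ ^ 2 ∂ν : ℝ) : ℂ) = ∑ j ∈ p.support, conj (p.coeff j) * moment hν j p := by
  have hconj (z : ℂ) : ((‖p.eval z‖ ^ 2 : ℝ) : ℂ)
      = ∑ j ∈ p.support, conj (p.coeff j) * (conj (z ^ j) * p.eval z) := by
    rw [Complex.ofReal_pow, ← Complex.conj_mul']
    nth_rw 1 [eval_eq_sum, Polynomial.sum_def]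
    simp only [map_sum, map_mul, Finset.sum_mul, mul_assoc]
  rw [← integral_complex_ofReal]
  simp only [hconj, moment_apply, ← integral_const_mul]
  exact integral_finsetSum _ fun j _ => integrable_of_continuous hν (by fun_prop)

lemma eq_zero_of_moment_eq_zero (hs : ∀ s : Set ℂ, s.Finite → ν sᶜ ≠ 0) {p : ℂ[X]}
    (hp : ∀ j ∈ p.support, moment hν j p = 0) : p = 0 := by
  have hnorm_sq : ∫ z, ‖p.eval z‖ ^ 2 ∂ν = 0 := by
    rw [← Complex.ofReal_eq_zero, integral_norm_eval_sq hν]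
    exact Finset.sum_eq_zero fun j hj => by rw [hp j hj, mul_zero]
  rw [integral_eq_zero_iff_of_nonneg (fun z => by positivity)
    (integrable_of_continuous hν (by fun_prop))] at hnorm_sq
  refine eq_zero_of_ae_eval_eq_zero hs ?_
  filter_upwards [hnorm_sq] with z hz
  exact norm_eq_zero.1 (pow_eq_zero_iff two_ne_zero |>.1 hz)

/-- The reversed polynomial `p^*(z) = z ^ n * conj (p (1 / conj z))` of Szegő's theory, for `p` of
degree at most `n`. -/
noncomputable def conjReflect (n : ℕ) (p : ℂ[X]) : ℂ[X] :=
  (p.map (starRingEnd ℂ)).reflect n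

section ConjReflect

variable {n : ℕ} {p : ℂ[X]}

lemma coeff_conjReflect (hp : p.natDegree ≤ n) (j : ℕ) :
    (conjReflect n p).coeff j = if j ≤ n then conj (p.coeff (n - j)) else 0 := by
  rw [conjReflect, coeff_reflect, coeff_map]
  split_ifs with hj
  · rw [revAt_le hj]
  · rw [revAt_eq_self_of_lt (not_le.1 hj), coeff_eq_zero_of_natDegree_lt (by omega), map_zero]

lemma natDegree_conjReflect_le (hp : p.natDegree ≤ n) : (conjReflect n p).natDegree ≤ n :=
  natDegree_le_iff_coeff_eq_zero.2 fun j hj => by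
    rw [coeff_conjReflect hp, if_neg (not_le.2 hj)]

lemma eval_conjReflect (hp : p.natDegree ≤ n) {z : ℂ} (hz : ‖z‖ = 1) :
    (conjReflect n p).eval z = z ^ n * conj (p.eval z) := by
  have hz' := conj_mul_self_of_norm_eq_one hz
  let _ : Invertible (conj z) := ⟨z, by rw [mul_comm, hz'], hz'⟩
  have hreflect : (conjReflect n p).eval z * conj z ^ n = conj (p.eval z) := by
    have := eval₂_reflect_mul_pow (RingHom.id ℂ) (conj z) n (p.map (starRingEnd ℂ))
      (natDegree_map_le.trans hp)
    rwa [← eval, ← eval, eval_map_apply] at this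
  rw [← hreflect, mul_left_comm, ← mul_pow, mul_comm z, hz', one_pow, mul_one]

lemma conjReflect_add (q : ℂ[X]) : conjReflect n (p + q) = conjReflect n p + conjReflect n q := by
  rw [conjReflect, Polynomial.map_add, reflect_add, conjReflect, conjReflect]

lemma conjReflect_C_mul (r : ℂ) : conjReflect n (C r * p) = C (conj r) * conjReflect n p := by
  rw [conjReflect, Polynomial.map_mul, map_C, reflect_C_mul, conjReflect]

lemma conjReflect_succ_X_mul (hp : p.natDegree ≤ n) :
    conjReflect (n + 1) (X * p) = conjReflect n p := by
  rw [conjReflect, Polynomial.map_mul, map_X, add_comm,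
    reflect_mul _ _ natDegree_X_le (natDegree_map_le.trans hp), reflect_one_X, one_mul, conjReflect]

lemma conjReflect_succ (hp : p.natDegree ≤ n) : conjReflect (n + 1) p = X * conjReflect n p := by
  have := reflect_mul 1 (p.map (starRingEnd ℂ)) (F := 1) (natDegree_one.trans_le zero_le_one)
    (natDegree_map_le.trans hp)
  rwa [one_mul, reflect_one, pow_one, add_comm] at this

lemma conjReflect_conjReflect : conjReflect n (conjReflect n p) = p := by
  rw [conjReflect, conjReflect, ← reflect_map, reflect_reflect]
  ext j
  rw [coeff_map, coeff_map, Complex.conj_conj]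

lemma moment_conjReflect (hp : p.natDegree ≤ n) {j : ℕ} (hj : j ≤ n) :
    moment hν j (conjReflect n p) = conj (moment hν (n - j) p) := by
  rw [moment_apply, moment_apply, ← integral_conj]
  refine integral_congr_ae ?_
  filter_upwards [ae_norm_eq_one hν] with z hz
  rw [eval_conjReflect hp hz, map_mul, Complex.conj_conj, map_pow,
    ← conj_pow_mul_pow_of_norm_eq_one hz hj, mul_assoc]

end ConjReflect

section SzegoRecursion

include hν

/-- The difference of the two sides has no coefficient outside the degrees `1, …, n`, and it is
orthogonal to those powers. -/
lemma IsMonicOPUC.szego_recursion (hs : ∀ s : Set ℂ, s.Finite → ν sᶜ ≠ 0) {n : ℕ} {p q : ℂ[X]}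
    (hp : IsMonicOPUC ν n p) (hq : IsMonicOPUC ν (n + 1) q) :
    q = X * p + C (q.eval 0) * conjReflect n p := by
  rw [← sub_eq_zero]
  refine eq_zero_of_moment_eq_zero hν hs fun j hj => ?_
  replace hj := mem_support_iff.1 hj
  rw [coeff_sub, coeff_add, coeff_C_mul, coeff_conjReflect hp.2.1.le] at hj
  rcases j with _ | j
  · rw [mul_coeff_zero, coeff_X_zero, if_pos n.zero_le, Nat.sub_zero, hp.coeff_self,
      coeff_zero_eq_eval_zero, map_one] at hj
    exact absurd (by ring) hj
  · rw [coeff_X_mul] at hj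
    have hjn : j + 1 ≤ n := by
      by_contra! hlt
      rw [if_neg hlt.not_ge, mul_zero, add_zero] at hj
      rcases (Nat.lt_succ_iff.1 hlt).eq_or_lt with rfl | hlt
      · rw [hp.coeff_self, hq.coeff_self, sub_self] at hj
        exact hj rfl
      · rw [coeff_eq_zero_of_natDegree_lt (hp.2.1.trans_lt hlt),
          coeff_eq_zero_of_natDegree_lt (hq.2.1.trans_lt (Nat.succ_lt_succ hlt)), sub_self] at hj
        exact hj rfl
    rw [map_sub, map_add, moment_C_mul, moment_succ_X_mul, moment_conjReflect hν hp.2.1.le hjn,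
      moment_apply, moment_apply, moment_apply, hp.2.2 j (by omega),
      hp.2.2 (n - (j + 1)) (by omega), hq.2.2 (j + 1) (by omega), map_zero, mul_zero,
      add_zero, sub_zero]

/-- The Szegő recursion with coefficients `β` for monic polynomials `Φ_n` and their reversals
`Ψ_n = Φ_n^*`. -/
structure IsSzegoPair (β : ℕ → ℂ) (Φ Ψ : ℕ → ℂ[X]) : Prop where
  fst_zero : Φ 0 = 1
  snd_zero : Ψ 0 = 1
  fst_succ : ∀ n, Φ (n + 1) = X * Φ n - C (conj (β n)) * Ψ n
  snd_succ : ∀ n, Ψ (n + 1) = Ψ n - C (β n) * (X * Φ n)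

theorem HasVerblunskyCoeffs.exists_isSzegoPair {β : ℕ → ℂ} (h : HasVerblunskyCoeffs ν β) :
    ∃ Φ : ℕ → ℂ[X], (∀ n, IsMonicOPUC ν n (Φ n)) ∧
      IsSzegoPair β Φ fun n => conjReflect n (Φ n) := by
  obtain ⟨hs, Φ, hΦ, hβ⟩ := h
  have hzero : Φ 0 = 1 := eq_one_of_monic_natDegree_zero (hΦ 0).1 (hΦ 0).2.1
  have hsucc (n : ℕ) : Φ (n + 1) = X * Φ n + C (-conj (β n)) * conjReflect n (Φ n) := by
    have := (hΦ n).szego_recursion hν hs (hΦ (n + 1))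
    rwa [← Complex.conj_conj ((Φ (n + 1)).eval 0), ← neg_neg (conj ((Φ (n + 1)).eval 0)), ← hβ,
      map_neg] at this
  have hdeg (n : ℕ) : (Φ n).natDegree ≤ n := (hΦ n).2.1.le
  refine ⟨Φ, hΦ, hzero, ?_, fun n => ?_, fun n => ?_⟩
  · simp only [hzero, conjReflect, Polynomial.map_one, reflect_one, pow_zero]
  · rw [hsucc n, C_neg, neg_mul, sub_eq_add_neg]
  · rw [hsucc n, conjReflect_add, conjReflect_succ_X_mul (hdeg n), conjReflect_C_mul,
      conjReflect_succ (natDegree_conjReflect_le (hdeg n)), conjReflect_conjReflect, map_neg,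
      Complex.conj_conj, C_neg, neg_mul, sub_eq_add_neg]

end SzegoRecursion

end UnitCircle

/-! ### Reduction of the Szegő recursion to a three-term recurrence -/

section Circle

open Complex (I)

lemma one_add_I_mul_ofReal_ne_zero (x : ℝ) : 1 + I * x ≠ 0 := fun h => by
  simpa using congrArg Complex.re h

lemma conj_one_add_I_mul_ofReal (x : ℝ) : conj (1 + I * x) = 1 - I * x := by
  rw [map_add, map_one, map_mul, Complex.conj_I, Complex.conj_ofReal, neg_mul, sub_eq_add_neg]

/-- The factor by which `circlePoly u a n` exceeds the monic orthogonal polynomial of degree `n`;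
the quantity `τ_n` of the paper is `conj (lead u n) / lead u n`. -/
noncomputable def lead (u : ℕ → ℝ) (n : ℕ) : ℂ :=
  ∏ j ∈ Finset.range n, (1 + I * u (j + 1))

lemma lead_succ (u : ℕ → ℝ) (n : ℕ) : lead u (n + 1) = lead u n * (1 + I * u (n + 1)) :=
  Finset.prod_range_succ _ _

lemma lead_ne_zero (u : ℕ → ℝ) (n : ℕ) : lead u n ≠ 0 :=
  Finset.prod_ne_zero_iff.2 fun _ _ => one_add_I_mul_ofReal_ne_zero _

/-- The Verblunsky coefficients `(1 - 2 g_{n+1} - i u_{n+1}) / (τ_n (1 - i u_{n+1}))`, written with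
`lead` in place of `τ`. -/
noncomputable def verblunsky (u g : ℕ → ℝ) (n : ℕ) : ℂ :=
  lead u n * (1 - 2 * g (n + 1) - I * u (n + 1)) / conj (lead u (n + 1))

lemma verblunsky_mul_conj_lead_succ (u g : ℕ → ℝ) (n : ℕ) :
    verblunsky u g n * conj (lead u (n + 1)) = lead u n * (1 - 2 * g (n + 1) - I * u (n + 1)) :=
  div_mul_cancel₀ _ ((_root_.map_ne_zero _).2 (lead_ne_zero u _))

lemma conj_verblunsky_mul_lead_succ (u g : ℕ → ℝ) (n : ℕ) :
    conj (verblunsky u g n) * lead u (n + 1)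
      = conj (lead u n) * (1 - 2 * g (n + 1) + I * u (n + 1)) := by
  have := congrArg conj (verblunsky_mul_conj_lead_succ u g n)
  simpa only [map_mul, map_sub, map_one, Complex.conj_conj, Complex.conj_I, Complex.conj_ofReal,
    Complex.conj_ofNat, neg_mul, sub_neg_eq_add] using this

/-- The polynomials on the unit circle that become `riiPoly u a` under the Cayley transform. -/
noncomputable def circlePoly (u a : ℕ → ℝ) : ℕ → ℂ[X]
  | 0 => 1
  | 1 => C (1 + I * u 1) * X + C (1 - I * u 1)
  | n + 2 => (C (1 + I * u (n + 2)) * X + C (1 - I * u (n + 2))) * circlePoly u a (n + 1)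
      - C (4 * a (n + 2) : ℂ) * X * circlePoly u a n

variable {u a g : ℕ → ℝ} {Φ Ψ : ℕ → ℂ[X]}

lemma natDegree_circlePoly_le : ∀ n, (circlePoly u a n).natDegree ≤ n
  | 0 => by rw [circlePoly, natDegree_one]
  | 1 => natDegree_linear_le
  | n + 2 => by
    refine (natDegree_sub_le _ _).trans (max_le ?_ ?_)
    · exact (natDegree_mul_le_of_le natDegree_linear_le (natDegree_circlePoly_le (n + 1))).trans
        (by omega)
    · exact (natDegree_mul_le_of_le (natDegree_C_mul_le _ X |>.trans natDegree_X_le)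
        (natDegree_circlePoly_le n)).trans (by omega)

lemma eval_circlePoly_one (z : ℂ) :
    (circlePoly u a 1).eval z = (1 + I * u 1) * z + (1 - I * u 1) := by
  simp only [circlePoly, eval_add, eval_mul, eval_C, eval_X]

lemma eval_circlePoly_add_two (z : ℂ) (n : ℕ) :
    (circlePoly u a (n + 2)).eval z
      = ((1 + I * u (n + 2)) * z + (1 - I * u (n + 2))) * (circlePoly u a (n + 1)).eval z
        - 4 * a (n + 2) * z * (circlePoly u a n).eval z := by
  simp only [circlePoly, eval_sub, eval_add, eval_mul, eval_C, eval_X]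

lemma conj_eval_circlePoly {z : ℂ} (hz : ‖z‖ = 1) :
    ∀ n, conj ((circlePoly u a n).eval z) = conj z ^ n * (circlePoly u a n).eval z
  | 0 => by rw [circlePoly, eval_one, map_one, pow_zero, one_mul]
  | 1 => by
    simp only [eval_circlePoly_one, map_add, map_mul, map_sub, map_one, Complex.conj_I,
      Complex.conj_ofReal]
    linear_combination -(1 + I * u 1 : ℂ) * conj_mul_self_of_norm_eq_one hz
  | n + 2 => by
    simp only [eval_circlePoly_add_two, map_add, map_mul, map_sub, map_one, Complex.conj_I,
      Complex.conj_ofReal, Complex.conj_ofNat, conj_eval_circlePoly hz (n + 1),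
      conj_eval_circlePoly hz n]
    linear_combination (4 * a (n + 2) * (circlePoly u a n).eval z
      - (1 + I * u (n + 2)) * (circlePoly u a (n + 1)).eval z)
        * conj z ^ (n + 1) * conj_mul_self_of_norm_eq_one hz

lemma IsSzegoPair.lead_mul_fst_succ (h : IsSzegoPair (verblunsky u g) Φ Ψ) (n : ℕ) :
    C (lead u (n + 1)) * Φ (n + 1)
      = C (1 + I * u (n + 1)) * X * (C (lead u n) * Φ n)
        - C (1 - 2 * g (n + 1) + I * u (n + 1)) * (C (conj (lead u n)) * Ψ n) := by
  have hβ := congrArg (C : ℂ → ℂ[X]) (conj_verblunsky_mul_lead_succ u g n)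
  have hlead := congrArg (C : ℂ → ℂ[X]) (lead_succ u n)
  rw [C_mul, C_mul] at hβ
  rw [C_mul] at hlead
  rw [h.fst_succ]
  linear_combination X * Φ n * hlead - Ψ n * hβ

lemma IsSzegoPair.conj_lead_mul_snd_succ (h : IsSzegoPair (verblunsky u g) Φ Ψ) (n : ℕ) :
    C (conj (lead u (n + 1))) * Ψ (n + 1)
      = C (1 - I * u (n + 1)) * (C (conj (lead u n)) * Ψ n)
        - C (1 - 2 * g (n + 1) - I * u (n + 1)) * (X * (C (lead u n) * Φ n)) := by
  have hβ := congrArg (C : ℂ → ℂ[X]) (verblunsky_mul_conj_lead_succ u g n)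
  have hlead := congrArg (C : ℂ → ℂ[X]) (congrArg conj (lead_succ u n))
  rw [C_mul, C_mul] at hβ
  rw [map_mul, conj_one_add_I_mul_ofReal, C_mul] at hlead
  rw [h.snd_succ]
  linear_combination Ψ n * hlead - X * Φ n * hβ

lemma IsSzegoPair.lead_mul_fst_sub_snd_succ (h : IsSzegoPair (verblunsky u g) Φ Ψ) (n : ℕ) :
    C (lead u (n + 1)) * Φ (n + 1) - C (conj (lead u (n + 1))) * Ψ (n + 1)
      = C (2 * (1 - g (n + 1) : ℂ)) * (C (lead u n) * (X * Φ n) - C (conj (lead u n)) * Ψ n) := by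
  rw [h.lead_mul_fst_succ, h.conj_lead_mul_snd_succ]
  simp only [C_add, C_sub, C_mul, C_1, C_ofNat]
  ring

lemma IsSzegoPair.lead_mul_X_mul_fst_sub_snd_succ (h : IsSzegoPair (verblunsky u g) Φ Ψ) (n : ℕ) :
    C (lead u (n + 1)) * (X * Φ (n + 1)) - C (conj (lead u (n + 1))) * Ψ (n + 1)
      = (C (1 + I * u (n + 1)) * X + C (1 - I * u (n + 1)))
          * (C (lead u n) * (X * Φ n) - C (conj (lead u n)) * Ψ n)
        - C (2 * g (n + 1) : ℂ) * X * (C (lead u n) * Φ n - C (conj (lead u n)) * Ψ n) := by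
  rw [mul_left_comm, h.lead_mul_fst_succ, h.conj_lead_mul_snd_succ]
  simp only [C_add, C_sub, C_mul, C_1, C_ofNat]
  ring

theorem IsSzegoPair.X_sub_one_mul_circlePoly (h : IsSzegoPair (verblunsky u g) Φ Ψ)
    (ha : ∀ n, a (n + 2) = (1 - g (n + 1)) * g (n + 2)) :
    ∀ n, (X - 1) * circlePoly u a n
      = C (lead u n) * (X * Φ n) - C (conj (lead u n)) * Ψ n
  | 0 => by
    simp only [circlePoly, lead, Finset.range_zero, Finset.prod_empty, map_one, h.fst_zero,
      h.snd_zero, mul_one, one_mul]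
  | 1 => by
    rw [h.lead_mul_X_mul_fst_sub_snd_succ]
    simp only [circlePoly, lead, Finset.range_zero, Finset.prod_empty, map_one, h.fst_zero,
      h.snd_zero, mul_one, sub_self, mul_zero, sub_zero, zero_add, one_mul]
    ring
  | n + 2 => by
    rw [h.lead_mul_X_mul_fst_sub_snd_succ, h.lead_mul_fst_sub_snd_succ,
      ← h.X_sub_one_mul_circlePoly ha (n + 1), ← h.X_sub_one_mul_circlePoly ha n, circlePoly, ha]
    push_cast
    simp only [C_sub, C_mul, C_1, C_ofNat]
    ring

lemma IsSzegoPair.circlePoly_succ (h : IsSzegoPair (verblunsky u g) Φ Ψ)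
    (ha : ∀ n, a (n + 2) = (1 - g (n + 1)) * g (n + 2)) (n : ℕ) :
    circlePoly u a (n + 1)
      = C (conj (lead u (n + 1))) * Ψ (n + 1)
        + C (2 * (1 - g (n + 1)) : ℂ) * (X * circlePoly u a n) := by
  have hne : (X - 1 : ℂ[X]) ≠ 0 := X_sub_C_ne_zero 1
  refine mul_left_cancel₀ hne ?_
  linear_combination h.X_sub_one_mul_circlePoly ha (n + 1)
    - C (2 * (1 - g (n + 1)) : ℂ) * X * h.X_sub_one_mul_circlePoly ha n
    + X * h.lead_mul_fst_sub_snd_succ n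

/-- The product `(1 - g_1) ⋯ (1 - g_n)`, which is `γ_n^{(b;k)}` for the parameter sequence
`M^{(λ;k)}`. -/
noncomputable def riiNorm (g : ℕ → ℝ) (n : ℕ) : ℝ :=
  ∏ j ∈ Finset.range n, (1 - g (j + 1))

lemma riiNorm_succ (g : ℕ → ℝ) (n : ℕ) : riiNorm g (n + 1) = riiNorm g n * (1 - g (n + 1)) :=
  Finset.prod_range_succ _ _

lemma IsParameterSequence.riiNorm_pos (hg : IsParameterSequence a g) (n : ℕ) : 0 < riiNorm g n :=
  Finset.prod_pos fun j _ => sub_pos.2 (hg.lt_one j)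

lemma IsParameterSequence.eval_one_circlePoly (hg : IsParameterSequence a g) :
    ∀ n, (circlePoly u a n).eval 1
      = ((2 ^ n * riiNorm g n * ∑ i ∈ Finset.range (n + 1), wallTerm g i : ℝ) : ℂ)
  | 0 => by
    rw [circlePoly, eval_one, riiNorm, Finset.prod_range_zero, zero_add, Finset.sum_range_one,
      wallTerm, Finset.prod_range_zero, pow_zero, mul_one, mul_one, Complex.ofReal_one]
  | 1 => by
    have hw : (1 - g 1) * (1 + wallTerm g 1) = 1 := by
      rw [wallTerm, Finset.prod_range_one, zero_add]
      field_simp [(sub_pos.2 (hg.lt_one 0)).ne']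
      ring
    rw [eval_circlePoly_one, Finset.sum_range_succ, Finset.sum_range_one, riiNorm,
      Finset.prod_range_one, wallTerm, Finset.prod_range_zero, zero_add, mul_assoc, hw]
    push_cast
    ring
  | n + 2 => by
    have hw : (1 - g (n + 2)) * wallTerm g (n + 2) = g (n + 2) * wallTerm g (n + 1) := by
      rw [wallTerm_succ]
      field_simp [(sub_pos.2 (hg.lt_one (n + 1))).ne']
    have hsum : 2 * (2 ^ (n + 1) * riiNorm g (n + 1) * ∑ i ∈ Finset.range (n + 2), wallTerm g i)
        - 4 * a (n + 2) * (2 ^ n * riiNorm g n * ∑ i ∈ Finset.range (n + 1), wallTerm g i)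
        = 2 ^ (n + 2) * riiNorm g (n + 2) * ∑ i ∈ Finset.range (n + 3), wallTerm g i := by
      rw [hg.eq_mul, riiNorm_succ g (n + 1), riiNorm_succ g n, Finset.sum_range_succ _ (n + 2),
        Finset.sum_range_succ _ (n + 1)]
      linear_combination 2 ^ (n + 2) * riiNorm g n * (1 - g (n + 1)) * -hw
    rw [eval_circlePoly_add_two, hg.eval_one_circlePoly (n + 1), hg.eval_one_circlePoly n, ← hsum]
    push_cast
    ring

end Circle

section CircleOrthogonality

variable {ν : Measure ℂ} {u a g : ℕ → ℝ} (hν : ν (Metric.sphere (0 : ℂ) 1)ᶜ = 0)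

include hν

lemma moment_succ_circlePoly [IsFiniteMeasure ν] (hβ : HasVerblunskyCoeffs ν (verblunsky u g))
    (hg : IsParameterSequence a g) {n j : ℕ} (hj : j < n) :
    moment hν (j + 1) (circlePoly u a n) = moment hν j (circlePoly u a n) := by
  obtain ⟨Φ, hΦ, hpair⟩ := hβ.exists_isSzegoPair hν
  have hfst (i : ℕ) (hi : i < n) : moment hν i (Φ n) = 0 := (hΦ n).2.2 i hi
  have := congrArg (moment hν (j + 1)) (hpair.X_sub_one_mul_circlePoly hg.eq_mul n)
  rw [sub_one_mul, map_sub, map_sub, moment_C_mul, moment_C_mul, moment_succ_X_mul,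
    moment_succ_X_mul, moment_conjReflect hν (hΦ n).2.1.le hj, hfst j hj,
    hfst (n - (j + 1)) (by omega), map_zero, mul_zero, mul_zero, sub_zero, sub_eq_zero] at this
  exact this.symm

variable [IsProbabilityMeasure ν]

theorem moment_circlePoly (hβ : HasVerblunskyCoeffs ν (verblunsky u g))
    (hg : IsParameterSequence a g) {n j : ℕ} (hj : j ≤ n) :
    moment hν j (circlePoly u a n) = 2 ^ n * riiNorm g n := by
  have hconst : moment hν j (circlePoly u a n) = moment hν 0 (circlePoly u a n) := by
    induction j with
    | zero => rfl
    | succ j ih => rw [moment_succ_circlePoly hν hβ hg hj, ih (Nat.le_of_succ_le hj)]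
  rw [hconst]
  clear hconst hj
  induction n with
  | zero => simp [circlePoly, moment_apply, riiNorm]
  | succ n ih =>
    obtain ⟨Φ, hΦ, hpair⟩ := hβ.exists_isSzegoPair hν
    have hsnd : moment hν 1 (conjReflect (n + 1) (Φ (n + 1))) = 0 := by
      rw [moment_conjReflect hν (hΦ _).2.1.le (Nat.le_add_left 1 n), moment_apply,
        (hΦ (n + 1)).2.2 _ (by omega), map_zero]
    rw [← moment_succ_circlePoly hν hβ hg n.succ_pos, hpair.circlePoly_succ hg.eq_mul, map_add,
      moment_C_mul, moment_C_mul, hsnd, moment_succ_X_mul, ih, riiNorm_succ]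
    push_cast
    ring

theorem moment_mul_circlePoly (hβ : HasVerblunskyCoeffs ν (verblunsky u g))
    (hg : IsParameterSequence a g) {n : ℕ} {q : ℂ[X]} (hq : q.natDegree ≤ n) :
    moment hν n (q * circlePoly u a n) = q.eval 1 * (2 ^ n * riiNorm g n) := by
  nth_rw 1 [q.as_sum_range_C_mul_X_pow' (Nat.lt_succ_of_le hq)]
  rw [eval_eq_sum_range' (Nat.lt_succ_of_le hq), Finset.sum_mul, map_sum, Finset.sum_mul]
  refine Finset.sum_congr rfl fun i hi => ?_
  have hi' : i ≤ n := Nat.lt_succ_iff.1 (Finset.mem_range.1 hi)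
  have hshift := moment_X_pow_mul hν i (n - i) (circlePoly u a n)
  rw [Nat.sub_add_cancel hi'] at hshift
  rw [mul_assoc, moment_C_mul, hshift, moment_circlePoly hν hβ hg (n.sub_le i), one_pow, mul_one]

lemma integral_norm_circlePoly_sq (hβ : HasVerblunskyCoeffs ν (verblunsky u g))
    (hg : IsParameterSequence a g) (n : ℕ) :
    ∫ z, ‖(circlePoly u a n).eval z‖ ^ 2 ∂ν
      = (2 ^ n * riiNorm g n) ^ 2 * ∑ i ∈ Finset.range (n + 1), wallTerm g i := by
  have hmoment := moment_mul_circlePoly hν hβ hg (natDegree_circlePoly_le (u := u) (a := a) n)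
  rw [hg.eval_one_circlePoly] at hmoment
  have hnorm : ((∫ z, ‖(circlePoly u a n).eval z‖ ^ 2 ∂ν : ℝ) : ℂ)
      = moment hν n (circlePoly u a n * circlePoly u a n) := by
    rw [← integral_complex_ofReal, moment_apply]
    refine integral_congr_ae ?_
    filter_upwards [ae_norm_eq_one hν] with z hz
    rw [Complex.ofReal_pow, ← Complex.conj_mul', conj_eval_circlePoly hz, eval_mul, map_pow,
      mul_assoc]
  rw [← Complex.ofReal_inj, hnorm, hmoment]
  push_cast
  ring

/-- The Christoffel function of `ν` at `1` bounds its mass there, and `circlePoly u a n` is the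
extremal polynomial. -/
theorem measure_singleton_one_eq_zero (hβ : HasVerblunskyCoeffs ν (verblunsky u g))
    (hg : IsParameterSequence a g) (hw : ¬ Summable (wallTerm g)) : ν {1} = 0 := by
  by_contra hone
  have hmass : 0 < ν.real {1} := ENNReal.toReal_pos hone (measure_ne_top ν _)
  refine hw (summable_of_sum_range_le (c := 1 / ν.real {1}) hg.wallTerm_nonneg fun n => ?_)
  set W := ∑ i ∈ Finset.range (n + 1), wallTerm g i with hW
  have hle : ∑ i ∈ Finset.range n, wallTerm g i ≤ W := by
    rw [hW, Finset.sum_range_succ]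
    exact le_add_of_nonneg_right (hg.wallTerm_nonneg n)
  suffices ν.real {1} * W ≤ 1 from
    hle.trans ((le_div_iff₀ hmass).2 ((mul_comm _ _).trans_le this))
  have hbound := setIntegral_le_integral (s := {(1 : ℂ)})
    (integrable_of_continuous hν (f := fun z => ‖(circlePoly u a n).eval z‖ ^ 2) (by fun_prop))
    (Filter.Eventually.of_forall fun z => sq_nonneg _)
  rw [integral_singleton, hg.eval_one_circlePoly, Complex.norm_real, Real.norm_eq_abs, sq_abs,
    integral_norm_circlePoly_sq hν hβ hg, smul_eq_mul, mul_pow, mul_left_comm] at hbound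
  have hscale : 0 < (2 ^ n * riiNorm g n) ^ 2 := by have := hg.riiNorm_pos n; positivity
  have hWpos : 0 < W := Finset.sum_pos' (fun i _ => hg.wallTerm_nonneg i)
    ⟨0, Finset.mem_range.2 n.succ_pos, by simp only [wallTerm, Finset.prod_range_zero, one_pos]⟩
  have hsq : ν.real {1} * W ^ 2 ≤ W := le_of_mul_le_mul_left hbound hscale
  rw [sq, ← mul_assoc] at hsq
  exact le_of_mul_le_mul_right (hsq.trans_eq (one_mul W).symm) hWpos

end CircleOrthogonality

/-! ### Cayley transform -/

section Cayley

open Complex (I)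

lemma ofReal_sub_I_ne_zero (x : ℝ) : (x : ℂ) - I ≠ 0 := fun h => by
  simpa using congrArg Complex.im h

lemma ofReal_add_I_ne_zero (x : ℝ) : (x : ℂ) + I ≠ 0 := fun h => by
  simpa using congrArg Complex.im h

lemma cayley_sub_one (x : ℝ) : cayley x - 1 = 2 * I / (x - I) := by
  rw [cayley, div_sub_one (ofReal_sub_I_ne_zero x)]
  ring

lemma cayley_add_one (x : ℝ) : cayley x + 1 = 2 * x / (x - I) := by
  rw [cayley, div_add_one (ofReal_sub_I_ne_zero x)]
  ring

lemma conj_cayley (x : ℝ) : conj (cayley x) = (x - I) / (x + I) := by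
  rw [cayley, map_div₀, map_add, map_sub, Complex.conj_ofReal, Complex.conj_I, sub_neg_eq_add,
    sub_eq_add_neg]

lemma continuous_cayley : Continuous cayley :=
  Continuous.div (by fun_prop) (by fun_prop) ofReal_sub_I_ne_zero

lemma cayley_injective : Function.Injective cayley := by
  intro x y hxy
  have h := cayley_sub_one x
  rw [hxy, cayley_sub_one y, div_eq_div_iff (ofReal_sub_I_ne_zero y) (ofReal_sub_I_ne_zero x)] at h
  have := mul_left_cancel₀ (mul_ne_zero two_ne_zero Complex.I_ne_zero) h
  exact Complex.ofReal_injective (sub_left_injective this)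

lemma measurableEmbedding_cayley : MeasurableEmbedding cayley :=
  continuous_cayley.measurableEmbedding cayley_injective

lemma exists_cayley_eq {z : ℂ} (hz : ‖z‖ = 1) (hz1 : z ≠ 1) : ∃ x, cayley x = z := by
  have hconj := conj_mul_self_of_norm_eq_one hz
  have hsub : z - 1 ≠ 0 := sub_ne_zero.2 hz1
  have hsub_conj : conj z - 1 ≠ 0 := fun h => hz1 <| by rwa [sub_eq_zero.1 h, one_mul] at hconj
  have hreal : conj (I * (z + 1) / (z - 1)) = I * (z + 1) / (z - 1) := by
    simp only [map_div₀, map_mul, map_add, map_sub, map_one, Complex.conj_I]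
    rw [div_eq_div_iff hsub_conj hsub]
    linear_combination -2 * I * hconj
  obtain ⟨x, hx⟩ := Complex.conj_eq_iff_real.1 hreal
  refine ⟨x, ?_⟩
  rw [div_eq_iff hsub] at hx
  rw [cayley, div_eq_iff (ofReal_sub_I_ne_zero x)]
  linear_combination hx

lemma map_cayley_lineMeasure {ν : Measure ℂ} (hν : ν (Metric.sphere (0 : ℂ) 1)ᶜ = 0)
    (hone : ν {1} = 0) : (lineMeasure ν).map cayley = ν := by
  rw [lineMeasure, measurableEmbedding_cayley.map_comap]
  refine Measure.restrict_eq_self_of_ae_mem ?_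
  filter_upwards [ae_norm_eq_one hν, compl_mem_ae_iff.2 hone] with z hz hz1
  exact exists_cayley_eq hz hz1

/-- The polynomials `P_n` of the `R_II` recurrence
`P_{n+1} = (x - u_{n+1}) P_n - a_{n+1} (x ^ 2 + 1) P_{n-1}`, of which the associated complementary
Romanovski–Routh polynomials are the instance `u_n = c_{k+n}`, `a_n = d_{k+n}`. -/
noncomputable def riiPoly (u a : ℕ → ℝ) : ℕ → ℝ[X]
  | 0 => 1
  | 1 => X - C (u 1)
  | n + 2 => (X - C (u (n + 2))) * riiPoly u a (n + 1)
      - C (a (n + 2)) * (X ^ 2 + 1) * riiPoly u a n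

variable {u a g : ℕ → ℝ}

lemma two_pow_mul_eval_riiPoly (x : ℝ) :
    ∀ n, 2 ^ n * (((riiPoly u a n).eval x : ℝ) : ℂ)
      = (x - I) ^ n * (circlePoly u a n).eval (cayley x)
  | 0 => by simp only [riiPoly, circlePoly, eval_one, pow_zero, Complex.ofReal_one]
  | 1 => by
    have hz : (x - I) * cayley x = x + I := mul_div_cancel₀ _ (ofReal_sub_I_ne_zero x)
    simp only [riiPoly, eval_circlePoly_one, eval_sub, eval_X, eval_C, Complex.ofReal_sub]
    linear_combination -(1 + I * u 1) * hz - 2 * u 1 * Complex.I_mul_I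
  | n + 2 => by
    have hz : (x - I) * cayley x = x + I := mul_div_cancel₀ _ (ofReal_sub_I_ne_zero x)
    have ih := two_pow_mul_eval_riiPoly x n
    have ih_succ := two_pow_mul_eval_riiPoly x (n + 1)
    rw [eval_circlePoly_add_two]
    simp only [riiPoly, eval_add, eval_sub, eval_mul, eval_C, eval_X, eval_pow, eval_one]
    push_cast
    set r := (circlePoly u a n).eval (cayley x)
    set r' := (circlePoly u a (n + 1)).eval (cayley x)
    linear_combination 2 * ((x : ℂ) - u (n + 2)) * ih_succ
      - 4 * a (n + 2) * ((x : ℂ) ^ 2 + 1) * ih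
      + (4 * a (n + 2) * (x - I) ^ (n + 1) * r - (1 + I * u (n + 2)) * (x - I) ^ (n + 1) * r') * hz
      - (2 * u (n + 2) * (x - I) ^ (n + 1) * r' + 4 * a (n + 2) * (x - I) ^ n * r)
        * Complex.I_mul_I

lemma conj_pow_mul_eval_cayley {n j : ℕ} (hj : j ≤ n) (x : ℝ) :
    conj (cayley x ^ n) * ((X + 1) ^ j * (X - 1) ^ (n - j) * circlePoly u a n).eval (cayley x)
      = 4 ^ n * I ^ (n - j) * ((x ^ j * ((riiPoly u a n).eval x / (x ^ 2 + 1) ^ n) : ℝ) : ℂ) := by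
  have hsub := ofReal_sub_I_ne_zero x
  have hadd := ofReal_add_I_ne_zero x
  have hR : (circlePoly u a n).eval (cayley x)
      = 2 ^ n * (((riiPoly u a n).eval x : ℝ) : ℂ) / (x - I) ^ n := by
    rw [two_pow_mul_eval_riiPoly, mul_div_cancel_left₀ _ (pow_ne_zero n hsub)]
  have hsq : (x : ℂ) ^ 2 + 1 = (x - I) * (x + I) := by linear_combination Complex.I_mul_I
  have hfour : (4 : ℂ) = 2 * 2 := by norm_num
  obtain ⟨m, rfl⟩ := Nat.exists_eq_add_of_le hj
  simp only [eval_mul, eval_pow, eval_add, eval_sub, eval_X, eval_one, hR, cayley_sub_one,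
    cayley_add_one, map_pow, conj_cayley, Nat.add_sub_cancel_left]
  push_cast
  rw [hsq, hfour]
  simp only [div_pow, mul_pow, pow_add]
  field_simp

/-- The polynomials `p_n` satisfy `∫ x ^ j p_n(x) / (x ^ 2 + 1) ^ n dφ(x) = γ_n δ_{n,j}` for
`j ≤ n`, all these integrals being absolutely convergent. -/
def IsRIIOrthogonal (φ : Measure ℝ) (p : ℕ → ℝ[X]) (γ : ℕ → ℝ) : Prop :=
  ∀ n j : ℕ, j ≤ n →
    Integrable (fun x : ℝ => x ^ j * ((p n).eval x / (x ^ 2 + 1) ^ n)) φ ∧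
    ∫ x : ℝ, x ^ j * ((p n).eval x / (x ^ 2 + 1) ^ n) ∂φ = if n = j then γ n else 0

lemma natDegree_X_add_one_pow_mul_X_sub_one_pow_le {n j : ℕ} (hj : j ≤ n) :
    ((X + 1) ^ j * (X - 1) ^ (n - j) : ℂ[X]).natDegree ≤ n := by
  compute_degree
  omega

variable {ν : Measure ℂ} [IsProbabilityMeasure ν]

theorem isRIIOrthogonal_lineMeasure (hν : ν (Metric.sphere (0 : ℂ) 1)ᶜ = 0)
    (hβ : HasVerblunskyCoeffs ν (verblunsky u g)) (hg : IsParameterSequence a g)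
    (hw : ¬ Summable (wallTerm g)) :
    IsRIIOrthogonal (lineMeasure ν) (riiPoly u a) (riiNorm g) := by
  intro n j hj
  have hmap := map_cayley_lineMeasure hν (measure_singleton_one_eq_zero hν hβ hg hw)
  set q : ℂ[X] := (X + 1) ^ j * (X - 1) ^ (n - j) with hq
  set f : ℝ → ℝ := fun x => x ^ j * ((riiPoly u a n).eval x / (x ^ 2 + 1) ^ n)
  have hc : (4 : ℂ) ^ n * I ^ (n - j) ≠ 0 :=
    mul_ne_zero (pow_ne_zero _ (OfNat.ofNat_ne_zero 4)) (pow_ne_zero _ Complex.I_ne_zero)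
  have hpull (x : ℝ) : conj (cayley x ^ n) * (q * circlePoly u a n).eval (cayley x)
      = 4 ^ n * I ^ (n - j) * (f x : ℂ) := conj_pow_mul_eval_cayley hj x
  constructor
  · have hcirc : Integrable (fun z => conj (z ^ n) * (q * circlePoly u a n).eval z) ν :=
      integrable_of_continuous hν (by fun_prop)
    rw [← hmap, measurableEmbedding_cayley.integrable_map_iff] at hcirc
    simp only [Function.comp_def, hpull] at hcirc
    rw [integrable_const_mul_iff hc.isUnit] at hcirc
    exact hcirc.re
  · have hline : 4 ^ n * I ^ (n - j) * ((∫ x, f x ∂lineMeasure ν : ℝ) : ℂ)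
        = q.eval 1 * (2 ^ n * riiNorm g n) := by
      rw [← moment_mul_circlePoly hν hβ hg (natDegree_X_add_one_pow_mul_X_sub_one_pow_le hj),
        moment_apply, ← integral_complex_ofReal, ← integral_const_mul]
      simp only [← hpull]
      rw [← measurableEmbedding_cayley.integral_map fun z =>
        conj (z ^ n) * (q * circlePoly u a n).eval z, hmap]
    rw [← Complex.ofReal_inj]
    refine mul_left_cancel₀ hc (hline.trans ?_)
    simp only [hq, eval_mul, eval_pow, eval_add, eval_sub, eval_X, eval_one, sub_self]
    rcases hj.eq_or_lt with rfl | hlt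
    · rw [if_pos rfl, Nat.sub_self, show (4 : ℂ) = (1 + 1) * 2 by norm_num, mul_pow]
      ring
    · rw [if_neg hlt.ne', zero_pow (by omega), Complex.ofReal_zero, mul_zero, mul_zero, zero_mul]

end Cayley

/-! ### Polynomials of the second kind -/

section SecondKind

variable {u a γ : ℕ → ℝ} {φ : Measure ℝ}

/-- The rational function `P_n(t) / (t ^ 2 + 1) ^ n`, where `P_n = riiPoly u a n`. -/
noncomputable def riiRatio (u a : ℕ → ℝ) (n : ℕ) (t : ℝ) : ℝ :=
  (riiPoly u a n).eval t / (t ^ 2 + 1) ^ n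

lemma pow_mul_riiRatio (n : ℕ) (t : ℝ) :
    (t ^ 2 + 1) ^ n * riiRatio u a n t = (riiPoly u a n).eval t :=
  mul_div_cancel₀ _ (by positivity)

lemma differentiable_riiRatio (n : ℕ) : Differentiable ℝ (riiRatio u a n) :=
  (riiPoly u a n).differentiable.div (by fun_prop) fun t => by positivity

lemma sq_add_one_mul_riiRatio_add_two (n : ℕ) (t : ℝ) :
    (t ^ 2 + 1) * riiRatio u a (n + 2) t
      = (t - u (n + 2)) * riiRatio u a (n + 1) t - a (n + 2) * riiRatio u a n t := by
  have hpos : (t ^ 2 + 1) ^ (n + 1) ≠ 0 := by positivity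
  apply mul_left_cancel₀ hpos
  have h := pow_mul_riiRatio (u := u) (a := a) (n + 2) t
  simp only [riiPoly, eval_sub, eval_mul, eval_X, eval_C, eval_add, eval_pow, eval_one,
    ← pow_mul_riiRatio] at h
  linear_combination h

/-- The inhomogeneous term of the recurrence of `riiQuotient`. -/
noncomputable def riiDefect (u a : ℕ → ℝ) (x : ℝ) (n : ℕ) (t : ℝ) : ℝ :=
  riiRatio u a n t - (t + x) * riiRatio u a (n + 1) t

/-- The quotient `((1 + x ^ 2) ^ n P_n(t) / (1 + t ^ 2) ^ n - P_n(x)) / (t - x)`, where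
`P_n = riiPoly u a n`. It is generated by its recurrence, so that no division by `t - x` occurs. -/
noncomputable def riiQuotient (u a : ℕ → ℝ) (x : ℝ) : ℕ → ℝ → ℝ
  | 0, _ => 0
  | 1, t => riiDefect u a x 0 t
  | n + 2, t => (x - u (n + 2)) * riiQuotient u a x (n + 1) t
      - a (n + 2) * (x ^ 2 + 1) * riiQuotient u a x n t
      + (1 + x ^ 2) ^ (n + 1) * riiDefect u a x (n + 1) t

lemma sub_mul_riiQuotient (x t : ℝ) :
    ∀ n, (t - x) * riiQuotient u a x n t
      = (1 + x ^ 2) ^ n * riiRatio u a n t - (riiPoly u a n).eval x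
  | 0 => by simp [riiQuotient, riiRatio, riiPoly]
  | 1 => by
    have h := pow_mul_riiRatio (u := u) (a := a) 1 t
    simp only [riiPoly, eval_sub, eval_X, eval_C] at h
    simp only [riiQuotient, riiDefect, riiPoly, eval_sub, eval_X, eval_C,
      show riiRatio u a 0 t = 1 by simp [riiRatio, riiPoly]]
    linear_combination -h
  | n + 2 => by
    have ih := sub_mul_riiQuotient x t n
    have ih_succ := sub_mul_riiQuotient x t (n + 1)
    simp only [riiQuotient, riiDefect, riiPoly, eval_sub, eval_mul, eval_X, eval_C, eval_add,
      eval_pow, eval_one]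
    linear_combination (x - u (n + 2)) * ih_succ - a (n + 2) * (x ^ 2 + 1) * ih
      - (1 + x ^ 2) ^ (n + 1) * sq_add_one_mul_riiRatio_add_two (u := u) (a := a) n t

lemma differentiable_riiDefect (x : ℝ) (n : ℕ) : Differentiable ℝ (riiDefect u a x n) :=
  (differentiable_riiRatio n).sub
    ((differentiable_id.add_const x).mul (differentiable_riiRatio (n + 1)))

lemma differentiable_riiQuotient (x : ℝ) : ∀ n, Differentiable ℝ (riiQuotient u a x n)
  | 0 => differentiable_const 0
  | 1 => differentiable_riiDefect x 0
  | n + 2 => (((differentiable_riiQuotient x (n + 1)).const_mul _).sub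
      ((differentiable_riiQuotient x n).const_mul _)).add
      ((differentiable_riiDefect x (n + 1)).const_mul _)

lemma dslope_sub_mul {𝕜 : Type*} [NontriviallyNormedField 𝕜] {F : 𝕜 → 𝕜} {x : 𝕜}
    (hF : DifferentiableAt 𝕜 F x) (t : 𝕜) :
    dslope (fun s => (s - x) * F s) x t = F t := by
  rcases eq_or_ne t x with rfl | ht
  · rw [dslope_same]
    have hderiv := ((hasDerivAt_id t).sub_const t).mul hF.hasDerivAt
    exact hderiv.deriv.trans (by simp)
  · exact dslope_sub_smul_of_ne F ht

lemma dslope_eq_pow_mul_riiQuotient (n : ℕ) (x t : ℝ) :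
    dslope (fun s : ℝ => (1 + x ^ 2) ^ n * (riiPoly u a n).eval s
        - (1 + s ^ 2) ^ n * (riiPoly u a n).eval x) x t
      = (1 + t ^ 2) ^ n * riiQuotient u a x n t := by
  have hfactor : (fun s : ℝ => (1 + x ^ 2) ^ n * (riiPoly u a n).eval s
        - (1 + s ^ 2) ^ n * (riiPoly u a n).eval x)
      = fun s => (s - x) * ((1 + s ^ 2) ^ n * riiQuotient u a x n s) := by
    funext s
    rw [← pow_mul_riiRatio n s]
    linear_combination (-(1 + s ^ 2) ^ n) * sub_mul_riiQuotient (u := u) (a := a) x s n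
  have hdiff := differentiable_riiQuotient (u := u) (a := a) x n
  rw [hfactor]
  exact dslope_sub_mul (F := fun s => (1 + s ^ 2) ^ n * riiQuotient u a x n s) (by fun_prop) t

namespace IsRIIOrthogonal

variable (h : IsRIIOrthogonal φ (riiPoly u a) γ)
include h

lemma integrable_riiRatio (n : ℕ) : Integrable (riiRatio u a n) φ :=
  (h n 0 n.zero_le).1.congr (.of_forall fun _ => by simp only [pow_zero, one_mul, riiRatio])

lemma integral_riiRatio (n : ℕ) : ∫ t, riiRatio u a n t ∂φ = if n = 0 then γ n else 0 := by
  simpa only [riiRatio, pow_zero, one_mul] using (h n 0 n.zero_le).2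

lemma integrable_mul_riiRatio (n : ℕ) : Integrable (fun t => t * riiRatio u a (n + 1) t) φ := by
  simpa only [riiRatio, pow_one] using (h (n + 1) 1 n.succ_pos).1

lemma integral_mul_riiRatio (n : ℕ) :
    ∫ t, t * riiRatio u a (n + 1) t ∂φ = if n = 0 then γ (n + 1) else 0 := by
  simpa only [riiRatio, pow_one, add_eq_right] using (h (n + 1) 1 n.succ_pos).2

lemma integrable_riiDefect (x : ℝ) (n : ℕ) : Integrable (riiDefect u a x n) φ := by
  refine ((h.integrable_riiRatio n).sub ((h.integrable_mul_riiRatio n).add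
    ((h.integrable_riiRatio (n + 1)).const_mul x))).congr (.of_forall fun t => ?_)
  simp only [riiDefect, Pi.sub_apply, Pi.add_apply, add_mul]

lemma integral_riiDefect (x : ℝ) (n : ℕ) :
    ∫ t, riiDefect u a x n t ∂φ = if n = 0 then γ 0 - γ 1 else 0 := by
  have hx := (h.integrable_riiRatio (n + 1)).const_mul x
  have ht := h.integrable_mul_riiRatio n
  simp only [riiDefect, add_mul]
  rw [integral_sub (h.integrable_riiRatio n) (by exact ht.add hx), integral_add ht hx,
    integral_const_mul, h.integral_riiRatio, h.integral_riiRatio, h.integral_mul_riiRatio,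
    if_neg n.succ_ne_zero, mul_zero, add_zero]
  split_ifs with hn
  · rw [hn]
  · exact sub_zero 0

lemma integrable_riiQuotient (x : ℝ) : ∀ n, Integrable (riiQuotient u a x n) φ
  | 0 => integrable_zero ℝ ℝ φ
  | 1 => h.integrable_riiDefect x 0
  | n + 2 => (((integrable_riiQuotient x (n + 1)).const_mul _).sub
      ((integrable_riiQuotient x n).const_mul _)).add
      ((h.integrable_riiDefect x (n + 1)).const_mul _)

lemma integral_riiQuotient_add_two (x : ℝ) (n : ℕ) :
    ∫ t, riiQuotient u a x (n + 2) t ∂φ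
      = (x - u (n + 2)) * ∫ t, riiQuotient u a x (n + 1) t ∂φ
        - a (n + 2) * (x ^ 2 + 1) * ∫ t, riiQuotient u a x n t ∂φ := by
  have hn := (h.integrable_riiQuotient x n).const_mul (a (n + 2) * (x ^ 2 + 1))
  have hn1 := (h.integrable_riiQuotient x (n + 1)).const_mul (x - u (n + 2))
  have hdefect := h.integrable_riiDefect x (n + 1)
  simp only [riiQuotient]
  rw [integral_add (by exact hn1.sub hn) (hdefect.const_mul _), integral_sub hn1 hn,
    integral_const_mul, integral_const_mul, integral_const_mul, h.integral_riiDefect,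
    if_neg n.succ_ne_zero, mul_zero, add_zero]

theorem integral_riiQuotient_succ (x : ℝ) :
    ∀ n, ∫ t, riiQuotient u a x (n + 1) t ∂φ
      = (γ 0 - γ 1) * (riiPoly (fun m => u (m + 1)) (fun m => a (m + 1)) n).eval x
  | 0 => by
    simp only [riiQuotient, riiPoly, eval_one, mul_one]
    exact h.integral_riiDefect x 0
  | 1 => by
    rw [h.integral_riiQuotient_add_two, integral_riiQuotient_succ x 0]
    simp only [riiQuotient, integral_zero, riiPoly, eval_one, eval_sub, eval_X, eval_C]
    ring
  | n + 2 => by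
    rw [h.integral_riiQuotient_add_two, integral_riiQuotient_succ x n,
      integral_riiQuotient_succ x (n + 1)]
    simp only [riiPoly, eval_sub, eval_mul, eval_X, eval_C, eval_add, eval_pow, eval_one]
    ring

end IsRIIOrthogonal

end SecondKind

/-! ### The associated complementary Romanovski–Routh polynomials -/

section RomanovskiRouth

variable (b : ℂ) (k : ℕ)

lemma P_eq_riiPoly :
    ∀ n, P b k n = riiPoly (fun m => c b (k + m)) (fun m => d b.re (k + m)) n
  | 0 => rfl
  | 1 => rfl
  | n + 2 => by
    rw [P, riiPoly, P_eq_riiPoly n, P_eq_riiPoly (n + 1)]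
    simp only [add_assoc]

lemma P_succ_eq_riiPoly (n : ℕ) :
    P b (k + 1) n = riiPoly (fun m => c b (k + (m + 1))) (fun m => d b.re (k + (m + 1))) n := by
  simp only [P_eq_riiPoly, add_assoc, add_comm 1]

lemma tau_eq_conj_lead_div_lead :
    ∀ n, tau b k n = conj (lead (fun m => c b (k + m)) n) / lead (fun m => c b (k + m)) n
  | 0 => by simp only [tau, lead, Finset.prod_range_zero, map_one, div_one]
  | n + 1 => by
    rw [tau, tau_eq_conj_lead_div_lead n, lead_succ, map_mul, conj_one_add_I_mul_ofReal,
      div_mul_div_comm]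

lemma beta_eq_verblunsky : beta b k = verblunsky (fun m => c b (k + m)) (M b.re k) := by
  funext n
  rw [beta, tau_eq_conj_lead_div_lead, verblunsky, lead_succ, map_mul, conj_one_add_I_mul_ofReal,
    one_div_div, div_mul_div_comm]

lemma gam_eq_riiNorm (lam : ℝ) : ∀ n, gam lam k n = riiNorm (M lam k) n
  | 0 => rfl
  | n + 1 => by rw [gam, gam_eq_riiNorm lam n, riiNorm_succ, mul_comm]

lemma gam_zero_sub_gam_one (lam : ℝ) : gam lam k 0 - gam lam k 1 = M lam k 1 := by
  simp only [gam, zero_add, mul_one, sub_sub_cancel]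

variable {b k}

lemma Admissible.isRIIOrthogonal (h : Admissible b.re k) {ν : Measure ℂ} [IsProbabilityMeasure ν]
    (hν : ν (Metric.sphere (0 : ℂ) 1)ᶜ = 0) (hβ : HasVerblunskyCoeffs ν (beta b k)) :
    IsRIIOrthogonal (lineMeasure ν) (P b k) (gam b.re k) := by
  rw [beta_eq_verblunsky] at hβ
  rw [funext (P_eq_riiPoly b k), funext (gam_eq_riiNorm k b.re)]
  exact isRIIOrthogonal_lineMeasure hν hβ h.isParameterSequence h.not_summable_wallTerm

lemma divDiff_div_eq (n : ℕ) (x t m : ℝ) :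
    divDiff b k n x t / (m * (1 + t ^ 2) ^ n)
      = m⁻¹ * riiQuotient (fun i => c b (k + i)) (fun i => d b.re (k + i)) x n t := by
  have hpos : (1 + t ^ 2) ^ n ≠ 0 := by positivity
  rw [divDiff, P_eq_riiPoly, dslope_eq_pow_mul_riiQuotient, mul_comm m, mul_div_mul_left _ _ hpos,
    inv_mul_eq_div]

theorem IsRIIOrthogonal.P_succ_eq_integral_divDiff {φ : Measure ℝ} {γ : ℕ → ℝ}
    (h : IsRIIOrthogonal φ (P b k) γ) (hγ : γ 0 - γ 1 ≠ 0) (n : ℕ) (x : ℝ) :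
    Integrable (fun t => divDiff b k (n + 1) x t / ((γ 0 - γ 1) * (1 + t ^ 2) ^ (n + 1))) φ ∧
    (P b (k + 1) n).eval x
      = ∫ t, divDiff b k (n + 1) x t / ((γ 0 - γ 1) * (1 + t ^ 2) ^ (n + 1)) ∂φ := by
  rw [funext (P_eq_riiPoly b k)] at h
  simp only [divDiff_div_eq]
  refine ⟨(h.integrable_riiQuotient x (n + 1)).const_mul _, ?_⟩
  rw [integral_const_mul, h.integral_riiQuotient_succ, inv_mul_cancel_left₀ hγ, P_succ_eq_riiPoly]

end RomanovskiRouth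

end CRR

theorem mainTheorem6_general (b : ℂ) (k : ℕ) (h : CRR.Admissible b.re k) :
    CRR.IsMaximalParameterSequence (fun n => CRR.d b.re (k + n)) (CRR.M b.re k) ∧
    ∀ (ν : Measure ℂ) [IsProbabilityMeasure ν], ν (Metric.sphere (0 : ℂ) 1)ᶜ = 0 →
      CRR.HasVerblunskyCoeffs ν (CRR.beta b k) →
      CRR.IsRIIOrthogonal (CRR.lineMeasure ν) (CRR.P b k) (CRR.gam b.re k) ∧
      (∀ (n : ℕ) (x : ℝ),
        Integrable (fun t : ℝ =>
          CRR.divDiff b k (n + 1) x t / (CRR.M b.re k 1 * (1 + t ^ 2) ^ (n + 1)))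
          (CRR.lineMeasure ν) ∧
        (CRR.P b (k + 1) n).eval x
          = ∫ t : ℝ, CRR.divDiff b k (n + 1) x t / (CRR.M b.re k 1 * (1 + t ^ 2) ^ (n + 1))
              ∂(CRR.lineMeasure ν)) := by
  refine ⟨h.isParameterSequence.isMaximal_of_not_summable h.not_summable_wallTerm,
    fun ν _ hν hβ => ?_⟩
  have horth := h.isRIIOrthogonal hν hβ
  have hM : CRR.M b.re k 1 ≠ 0 := (h.M_succ_pos_and_lt_one 0).1.ne'
  rw [← CRR.gam_zero_sub_gam_one] at hM ⊢
  exact ⟨horth, horth.P_succ_eq_integral_divDiff hM⟩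

theorem mainTheorem6 (b : ℂ) (k : ℕ)
    (h : (k = 0 ∧ 1 / 2 < b.re) ∨ (1 ≤ k ∧ 0 < b.re)) :
    CRR.IsMaximalParameterSequence (fun n => CRR.d b.re (k + n)) (CRR.M b.re k) ∧
    ∀ (ν : Measure ℂ) [IsProbabilityMeasure ν], ν (Metric.sphere (0 : ℂ) 1)ᶜ = 0 →
      CRR.HasVerblunskyCoeffs ν (CRR.beta b k) →
      (∀ n j : ℕ, j ≤ n →
        Integrable (fun x : ℝ => x ^ j * ((CRR.P b k n).eval x / (x ^ 2 + 1) ^ n))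
          (CRR.lineMeasure ν) ∧
        ∫ x : ℝ, x ^ j * ((CRR.P b k n).eval x / (x ^ 2 + 1) ^ n) ∂(CRR.lineMeasure ν)
          = if n = j then CRR.gam b.re k n else 0) ∧
      (∀ (n : ℕ) (x : ℝ),
        Integrable (fun t : ℝ =>
          CRR.divDiff b k (n + 1) x t / (CRR.M b.re k 1 * (1 + t ^ 2) ^ (n + 1)))
          (CRR.lineMeasure ν) ∧
        (CRR.P b (k + 1) n).eval x
          = ∫ t : ℝ, CRR.divDiff b k (n + 1) x t / (CRR.M b.re k 1 * (1 + t ^ 2) ^ (n + 1))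
              ∂(CRR.lineMeasure ν)) := by
  exact mainTheorem6_general b k (h.imp And.right fun hk =>
    ⟨hk.1, by linarith [hk.2, k.cast_nonneg (α := ℝ)]⟩)
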